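/- Let $D$ be a planar diagram, with blackboard framing, of an oriented framed link $L$ with $l$ components, and let $\mathbf n=(n_1,\dots,n_l)$ be a sequence of natural numbers (the colors). For $\mathbf m=(m_1,\dots,m_l)$ let $D^{\mathbf m}$ be the $\mathbf m$-cable of $D$: the $i$-th component is replaced by $m_i$ parallel strands, numbered from left to right; the odd-numbered strands are oriented like the component and the even-numbered ones oppositely. For a diagram $E$ with $c_+$ positive and $c_-$ negative crossings let $\mathrm{Kh}^r(E)$ be the formal direct sum, over all smoothings of $E$ with $r+c_-$ crossings smoothed by the 1-smoothing, of the circle configurations obtained, each with its degree shifted by $\{r+c_+-c_-\}$. Let $\mathcal F_{\mathrm{Kh}}(\mathcal O)$ be the graded $\mathbb Z[1/2]$-module spanned by the oriented cobordisms from $\emptyset$ to the circle configuration $\mathcal O$ (graded by the Euler characteristic), modulo the relations: (S) a cobordism with a sphere component is zero; (T) a torus component can be removed at the cost of a factor $2$; (4Tu) $C_{12}+C_{34}=C_{13}+C_{24}$, where $C_{ab}$ is $C$ with a tube connecting the $a$-th and the $b$-th of four discs on $C$; and a cobordism with a component of genus greater than $1$ is zero. The functor $\mathcal F_{\mathrm{Kh}}$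 is extended to formal direct sums and degree shifts. A $\mathbf k$-pairing is a choice, for every $i$, of $k_i$ disjoint pairs of neighbouring dots among $n_i$ dots on a line. The chain object of the colored Khovanov bracket $[[D_{\mathbf n}]]_{1,0}$ in bidegree $(i,r)$ is $\bigoplus_{|\mathbf k|=i}\bigoplus_{\mathbf s}\mathrm{Kh}^r(D^{\mathbf n-2\mathbf k})$, where $\mathbf s$ runs over the $\mathbf k$-pairings and $|\mathbf k|=\sum_i k_i$. Let $M^{i,r,j}$ be the homogeneous component of degree $j$ of its image under $\mathcal F_{\mathrm{Kh}}$. The total graded Euler characteristic of $\mathcal F_{\mathrm{Kh}}([[D_{\mathbf n}]]_{1,0})$ is, by definition, $$\chi=\sum_{i,r,j}(-1)^{i+r}q^j\dim_{\mathbb Q}\bigl(M^{i,r,j}\otimes_{\mathbb Z[1/2]}\mathbb Q\bigr).$$ Then all these dimensions are finite, only finitely many of them are nonzero, and $\chi\in\mathbb Z[q,q^{-1}]$ equals the colored Jones polynomial $$J_{\mathbf n}(L)=\sum_{\mathbf k=\mathbf 0}^{\lfloor\mathbf n/2\rfloor}(-1)^{|\mathbf k|}\prod_{i=1}^l\binom{n_i-k_i}{k_i}\;J(L^{\mathbf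 n-2\mathbf k}).$$ Here $J(L^{\mathbf m})$ is the unnormalized Jones polynomial of the link with diagram $E=D^{\mathbf m}$, i.e. $J=(-1)^{c_-}q^{c_+-2c_-}\sum_s(-q)^{h(s)}(q+q^{-1})^{o(s)}$, where $s$ runs over all smoothings of $E$, $h(s)$ is the number of 1-smoothings in $s$ and $o(s)$ the number of circles of $s$. -/

import Mathlib

open scoped LaurentPolynomial TensorProduct DirectSum

/-! ## Oriented link diagrams -/

/-- A generic diagram of an oriented link, given by its signed Gauss code. The components of the link
are indexed by `ι`, the crossings by `X`. A *pass* `(c, true)` or `(c, false)` is the upper or the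
lower strand at the crossing `c`. Travelling once around the component `i` along its orientation one
meets the passes `code i`, in this cyclic order (a component without crossings has the empty word).
`pos c` says whether `c` is a positive (right-handed) crossing. -/
structure LinkDiagram (ι X : Type) where
  /-- the word of passes met along a component -/
  code : ι → List (X × Bool)
  /-- the component on which a pass lies -/
  comp : X × Bool → ι
  /-- is the crossing positive? -/
  pos : X → Bool
  mem_code : ∀ i p, p ∈ code i ↔ comp p = i
  nodup_code : ∀ i, (code i).Nodup

namespace LinkDiagram

variable {ι X : Type}

/-- `q` is the pass that follows the pass `p` along the orientation of the link. -/
def Next (D : LinkDiagram ι X) (p q : X × Bool) : Prop :=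
  ∃ i n, (D.code i)[n]? = some p ∧ (D.code i)[(n + 1) % (D.code i).length]? = some q

/-- The four half-edges at the crossings: `(p, false)` is the half-edge arriving at the pass `p`,
`(p, true)` the one leaving it. -/
abbrev HalfEdge (X : Type) : Type := (X × Bool) × Bool

/-- The counterclockwise successor of a half-edge in the cyclic order of the four half-edges at
its crossing. At a positive crossing this order is: upper in, lower in, upper out, lower out; at a
negative crossing it is: upper in, lower out, upper out, lower in. -/
def ccw (D : LinkDiagram ι X) : HalfEdge X → HalfEdge X
  | ((c, true), out) => ((c, false), if D.pos c then out else !out)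
  | ((c, false), out) => ((c, true), if D.pos c then !out else out)

/-- Two half-edges which follow each other on the boundary of a region of the diagram: turn to the
counterclockwise neighbour, then run along its edge. -/
inductive SameFace (D : LinkDiagram ι X) : HalfEdge X → HalfEdge X → Prop
  | forward (h : HalfEdge X) (p q : X × Bool) :
      D.ccw h = (p, true) → D.Next p q → SameFace D h (q, false)
  | backward (h : HalfEdge X) (p q : X × Bool) :
      D.ccw h = (q, false) → D.Next p q → SameFace D h (p, true)

/-- The Gauss code is that of a diagram in the plane: the surface obtained from the underlying
4-valent graph (with `card X` vertices and `2 * card X` edges) by gluing a disc to each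
boundary walk is a union of spheres, i.e. `V - E + F = 2 K`, where `K` is the number of connected
components of the graph. -/
def IsPlanar (D : LinkDiagram ι X) : Prop :=
  Nat.card (Quot D.SameFace) =
    Nat.card X + 2 * Nat.card (Quot fun c d : X => ∃ s t, D.Next (c, s) (d, t))

/-! ## Cables -/

/-- The crossings of the `m`-cable: each crossing of `D` is replaced by a grid of crossings of the
strand `a` of the upper cable with the strand `b` of the lower cable. -/
abbrev CableCrossing (D : LinkDiagram ι X) (m : ι → ℕ) : Type :=
  Σ c : X, Fin (m (D.comp (c, true))) × Fin (m (D.comp (c, false)))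

/-- The passes met by the strand `a` of the cable of the component `i` (strands are numbered from
left to right) near a pass `p` of that component, in the direction of the component. At a
positive crossing the lower cable crosses the upper one from right to left, at a negative one from
left to right. -/
def cablePass (D : LinkDiagram ι X) (m : ι → ℕ) {i : ι} (a : Fin (m i)) :
    (p : X × Bool) → D.comp p = i → List (D.CableCrossing m × Bool)
  | (c, true), h =>
      (if D.pos c then List.finRange (m (D.comp (c, false)))
        else (List.finRange (m (D.comp (c, false)))).reverse).map
        fun b => (⟨c, Fin.cast (congrArg m h.symm) a, b⟩, true)
  | (c, false), h =>
      (if D.pos c then (List.finRange (m (D.comp (c, true)))).reverse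
        else List.finRange (m (D.comp (c, true)))).map
        fun b => (⟨c, b, Fin.cast (congrArg m h.symm) a⟩, false)

/-- The passes of a strand of the cable in the direction of the original component. -/
def cableWord (D : LinkDiagram ι X) (m : ι → ℕ) (i : ι) (a : Fin (m i)) :
    List (D.CableCrossing m × Bool) :=
  (D.code i).attach.flatMap fun p => D.cablePass m a p.1 ((D.mem_code i p.1).1 p.2)

/-- The component of the cable on which a pass lies. -/
def cableComp (D : LinkDiagram ι X) (m : ι → ℕ) : D.CableCrossing m × Bool → Σ i, Fin (m i)
  | (x, true) => ⟨D.comp (x.1, true), x.2.1⟩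
  | (x, false) => ⟨D.comp (x.1, false), x.2.2⟩

theorem mem_cablePass (D : LinkDiagram ι X) (m : ι → ℕ) {i : ι} (a : Fin (m i))
    (p : X × Bool) (h : D.comp p = i) (y : D.CableCrossing m × Bool) :
    y ∈ D.cablePass m a p h ↔ (y.1.1, y.2) = p ∧ D.cableComp m y = ⟨i, a⟩ := by
  subst h
  obtain ⟨⟨c', a', b'⟩, s'⟩ := y
  obtain ⟨c, s⟩ := p
  have key : ∀ (P : Prop) [Decidable P] (n : ℕ) (x : Fin n),
      x ∈ (if P then List.finRange n else (List.finRange n).reverse) := by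
    intro P _ n x; split_ifs <;> simp
  have key' : ∀ (P : Prop) [Decidable P] (n : ℕ) (x : Fin n),
      x ∈ (if P then (List.finRange n).reverse else List.finRange n) := by
    intro P _ n x; split_ifs <;> simp
  cases s <;> cases s' <;> simp only [cablePass, cableComp, List.mem_map, key, key', true_and]
  · constructor
    · rintro ⟨b, hb⟩
      simp only [Prod.mk.injEq, Sigma.mk.injEq, and_true] at hb
      obtain ⟨rfl, hb⟩ := hb
      simp only [heq_eq_eq, Prod.mk.injEq] at hb
      simp [← hb.2]
    · rintro ⟨h1, h2⟩
      simp only [Prod.mk.injEq, and_true] at h1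
      subst h1
      simp only [Sigma.mk.injEq, heq_eq_eq, true_and] at h2
      subst h2
      exact ⟨a', rfl⟩
  · simp
  · simp
  · constructor
    · rintro ⟨b, hb⟩
      simp only [Prod.mk.injEq, Sigma.mk.injEq, and_true] at hb
      obtain ⟨rfl, hb⟩ := hb
      simp only [heq_eq_eq, Prod.mk.injEq] at hb
      simp [← hb.1]
    · rintro ⟨h1, h2⟩
      simp only [Prod.mk.injEq, and_true] at h1
      subst h1
      simp only [Sigma.mk.injEq, heq_eq_eq, true_and] at h2
      subst h2
      exact ⟨b', rfl⟩

theorem nodup_cablePass (D : LinkDiagram ι X) (m : ι → ℕ) {i : ι} (a : Fin (m i))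
    (p : X × Bool) (h : D.comp p = i) : (D.cablePass m a p h).Nodup := by
  obtain ⟨c, s⟩ := p
  cases s <;> simp only [cablePass]
  · apply List.Nodup.map
    · intro b b' hb
      simpa using hb
    · split_ifs <;> simp [List.nodup_finRange]
  · apply List.Nodup.map
    · intro b b' hb
      simpa using hb
    · split_ifs <;> simp [List.nodup_finRange]

theorem mem_cableWord (D : LinkDiagram ι X) (m : ι → ℕ) (i : ι) (a : Fin (m i))
    (y : D.CableCrossing m × Bool) :
    y ∈ D.cableWord m i a ↔ D.cableComp m y = ⟨i, a⟩ := by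
  simp only [cableWord, List.mem_flatMap, mem_cablePass]
  constructor
  · rintro ⟨p, -, -, h⟩
    exact h
  · intro h
    have hc : D.comp (y.1.1, y.2) = i := by
      obtain ⟨x, s⟩ := y
      cases s <;> exact congrArg Sigma.fst h
    exact ⟨⟨(y.1.1, y.2), (D.mem_code _ _).2 hc⟩, List.mem_attach _ _, rfl, h⟩

theorem nodup_cableWord (D : LinkDiagram ι X) (m : ι → ℕ) (i : ι) (a : Fin (m i)) :
    (D.cableWord m i a).Nodup := by
  rw [cableWord, List.nodup_flatMap]
  refine ⟨fun p _ => D.nodup_cablePass m a _ _, ?_⟩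
  refine (List.nodup_attach.2 (D.nodup_code i)).imp ?_
  intro p p' hne y hy hy'
  rw [mem_cablePass] at hy hy'
  exact hne (Subtype.ext (hy.1.symm.trans hy'.1))

/-- The `m`-cable of `D` in the blackboard framing: the component `i` is replaced by `m i` parallel
strands numbered `0, 1, 2, …` from left to right, oriented alternatingly like the component
and oppositely to it. -/
def cable (D : LinkDiagram ι X) (m : ι → ℕ) :
    LinkDiagram (Σ i, Fin (m i)) (D.CableCrossing m) where
  code := fun x => if Even x.2.val then D.cableWord m x.1 x.2 else (D.cableWord m x.1 x.2).reverse
  comp := D.cableComp m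
  pos := fun x => if Even (x.2.1.val + x.2.2.val) then D.pos x.1 else !D.pos x.1
  mem_code := by
    rintro ⟨i, a⟩ y
    dsimp only
    split_ifs
    · exact D.mem_cableWord m i a y
    · rw [List.mem_reverse]
      exact D.mem_cableWord m i a y
  nodup_code := by
    rintro ⟨i, a⟩
    dsimp only
    split_ifs
    · exact D.nodup_cableWord m i a
    · exact List.nodup_reverse.2 (D.nodup_cableWord m i a)

/-! ## Smoothings -/

/-- The number of positive crossings. -/
def nPos [Fintype X] (D : LinkDiagram ι X) : ℕ := (Finset.univ.filter fun c => D.pos c = true).card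

/-- The number of negative crossings. -/
def nNeg [Fintype X] (D : LinkDiagram ι X) : ℕ := (Finset.univ.filter fun c => D.pos c = false).card

/-- The height of a vertex of the cube of resolutions: the number of 1-smoothings. -/
def height [Fintype X] (s : X → Bool) : ℕ := (Finset.univ.filter fun c => s c = true).card

/-- Half-edges that are joined, by an edge of the diagram or by an arc of the smoothing `s`
(`s c = true` for the 1-smoothing of `c`). The smoothing compatible with the orientations is the
0-smoothing of a positive and the 1-smoothing of a negative crossing. -/
inductive Joined (D : LinkDiagram ι X) (s : X → Bool) : HalfEdge X → HalfEdge X → Prop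
  | edge (p q : X × Bool) : D.Next p q → Joined D s (p, true) (q, false)
  | oriented (c : X) (up : Bool) : s c ≠ D.pos c →
      Joined D s ((c, up), false) ((c, !up), true)
  | unoriented (c : X) (out : Bool) : s c = D.pos c →
      Joined D s ((c, true), out) ((c, false), out)

/-- The circles of the smoothing `s`: those made of edges and smoothing arcs, and the components of
the link without crossings. -/
abbrev Circles (D : LinkDiagram ι X) (s : X → Bool) : Type :=
  Quot (D.Joined s) ⊕ {i : ι // D.code i = []}

/-! ## The Jones polynomial and the colored Jones polynomial -/

/-- The (unnormalized) Jones polynomial `J` of the oriented link with diagram `D`, as an element of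
`ℤ[q, q⁻¹]` with `q = T 1`, in Kauffman's form: `(-1) ^ c₋ q ^ (c₊ - 2 c₋) ⟨D⟩`, where the bracket is
`⟨D⟩ = ∑ (-q) ^ (number of 1-smoothings) (q + q⁻¹) ^ (number of circles)`, summed over all
smoothings. -/
noncomputable def jones [Fintype X] [DecidableEq X] (D : LinkDiagram ι X) : ℤ[T;T⁻¹] :=
  (-1) ^ D.nNeg * LaurentPolynomial.T ((D.nPos : ℤ) - 2 * D.nNeg) *
    ∑ s : X → Bool, (-LaurentPolynomial.T 1) ^ height s *
      (LaurentPolynomial.T 1 + LaurentPolynomial.T (-1)) ^ Nat.card (D.Circles s)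

/-- The colored Jones polynomial of the framed oriented link with blackboard diagram `D`, where the
component `i` has color `n i`. -/
noncomputable def coloredJones [Fintype ι] [DecidableEq ι] [Fintype X] [DecidableEq X]
    (D : LinkDiagram ι X) (n : ι → ℕ) : ℤ[T;T⁻¹] :=
  ∑ k ∈ Fintype.piFinset fun i => Finset.range (n i / 2 + 1),
    (-1) ^ (∑ i, k i) * ((∏ i, (n i - k i).choose (k i) : ℕ) : ℤ[T;T⁻¹]) *
      (D.cable fun i => n i - 2 * k i).jones

end LinkDiagram

/-! ## Cobordisms from the empty set and the Khovanov functor -/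

/-- The ring `ℤ[1/2]`, as a subring of `ℚ`. -/
abbrev ZHalf : Type := Algebra.adjoin ℤ ({1 / 2} : Set ℚ)

/-- A connected component of a cobordism from the empty set to a configuration of circles indexed by
`O`: the circles in its boundary, and its genus. -/
structure SurfaceComponent (O : Type) where
  /-- the boundary circles -/
  boundary : Finset O
  /-- the genus -/
  genus : ℕ

/-- The Euler characteristic of a connected surface. -/
def SurfaceComponent.euler {O : Type} (c : SurfaceComponent O) : ℤ :=
  2 - 2 * c.genus - c.boundary.card

open Classical in
/-- A finite collection of connected surfaces (some of them possibly closed) is a cobordism from the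
empty set to `O` if every circle is in the boundary of exactly one component. -/
def IsCobordism {O : Type} (C : Multiset (SurfaceComponent O)) : Prop :=
  ∀ x : O, C.countP (fun c => x ∈ c.boundary) = 1

/-- The cobordisms from the empty set to the circles `O`: compact oriented surfaces with boundary
`O`, up to homeomorphism relative to the boundary. By the classification of surfaces such a
cobordism is given by the boundary circles and the genus of each of its components. -/
abbrev Cobordism (O : Type) : Type := {C : Multiset (SurfaceComponent O) // IsCobordism C}

/-- The Euler characteristic of a cobordism; it is its topological degree. -/
def Cobordism.euler {O : Type} (C : Cobordism O) : ℤ := (C.1.map SurfaceComponent.euler).sum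

open Classical in
/-- The surface obtained from the surface with components `comp` by removing a disc from the
component `comp a` and a disc from the component `comp b` (two discs from `comp a` if `a = b`), and
gluing in a tube which connects the two boundaries. -/
noncomputable def tube {O : Type} {k : ℕ} (comp : Fin k → SurfaceComponent O) (a b : Fin k) :
    Multiset (SurfaceComponent O) :=
  (if a = b then ⟨(comp a).boundary, (comp a).genus + 1⟩
    else ⟨(comp a).boundary ∪ (comp b).boundary, (comp a).genus + (comp b).genus⟩) ::ₘ
  ((Finset.univ : Finset (Fin k)) \ {a, b}).val.map comp

theorem isCobordism_tube {O : Type} {k : ℕ} {comp : Fin k → SurfaceComponent O}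
    (h : IsCobordism (Finset.univ.val.map comp)) (a b : Fin k) : IsCobordism (tube comp a b) := by
  classical
  intro x
  have hx := h x
  simp only [tube, Multiset.countP_cons, Multiset.countP_map] at hx ⊢
  have conv : ∀ s : Finset (Fin k),
      (Multiset.filter (fun i => x ∈ (comp i).boundary) s.val).card =
        ∑ i ∈ s, if x ∈ (comp i).boundary then 1 else 0 := by
    intro s
    rw [← Finset.filter_val, Finset.card_val, Finset.card_filter]
  rw [conv] at hx ⊢
  rw [← Finset.sum_sdiff (Finset.subset_univ {a, b})] at hx
  by_cases hab : a = b
  · subst hab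
    simp only [Finset.pair_eq_singleton, Finset.sum_singleton, if_true] at hx ⊢
    exact hx
  · rw [Finset.sum_pair hab] at hx
    simp only [hab, if_false, Finset.mem_union]
    by_cases h1 : x ∈ (comp a).boundary <;> by_cases h2 : x ∈ (comp b).boundary <;>
      simp only [h1, h2, if_true, if_false, or_true, true_or, or_self] at hx ⊢ <;> omega

/-- The local relations: (S) a cobordism with a component that is a sphere is zero, (T) a component
that is a torus can be removed at the cost of a factor `2`, (4Tu) the four tube relation
`C₁₂ + C₃₄ = C₁₃ + C₂₄`, where `C` is a cobordism with four discs on it, on the components `a 0`,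
`a 1`, `a 2`, `a 3`, and `C₁₂` is `C` with a tube connecting the first two discs, etc. -/
inductive IsLocalRelator {O : Type} : (Cobordism O →₀ ZHalf) → Prop
  | sphere (C : Cobordism O) : ⟨∅, 0⟩ ∈ C.1 → IsLocalRelator (Finsupp.single C 1)
  | torus (C C' : Cobordism O) : C.1 = ⟨∅, 1⟩ ::ₘ C'.1 →
      IsLocalRelator (Finsupp.single C 1 - Finsupp.single C' 2)
  | fourTube {k : ℕ} (comp : Fin k → SurfaceComponent O)
      (h : IsCobordism (Finset.univ.val.map comp)) (a : Fin 4 → Fin k) :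
      IsLocalRelator
        (Finsupp.single ⟨tube comp (a 0) (a 1), isCobordism_tube h _ _⟩ 1 +
          Finsupp.single ⟨tube comp (a 2) (a 3), isCobordism_tube h _ _⟩ 1 -
          Finsupp.single ⟨tube comp (a 0) (a 2), isCobordism_tube h _ _⟩ 1 -
          Finsupp.single ⟨tube comp (a 1) (a 3), isCobordism_tube h _ _⟩ 1)

/-- The `ℤ[1/2]`-module of morphisms from the empty set to `O`: formal linear combinations of
cobordisms modulo the local relations. -/
noncomputable abbrev CobMor (O : Type) : Type :=
  (Cobordism O →₀ ZHalf) ⧸ Submodule.span ZHalf {z : Cobordism O →₀ ZHalf | IsLocalRelator z}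

/-- The morphism given by a cobordism. -/
noncomputable def CobMor.of {O : Type} (C : Cobordism O) : CobMor O :=
  Submodule.Quotient.mk (Finsupp.single C 1)

/-- The Khovanov functor on a configuration `O` of circles: the morphisms from the empty set to `O`,
where moreover all cobordisms with a component of genus greater than `1` are set to be zero. -/
noncomputable abbrev FKh (O : Type) : Type :=
  CobMor O ⧸ Submodule.span ZHalf
    {z : CobMor O | ∃ C : Cobordism O, (∃ c ∈ C.1, 1 < c.genus) ∧ z = CobMor.of C}

/-- The homogeneous component of degree `j` of the graded module `FKh O`. -/
noncomputable def FKh.degreePart (O : Type) (j : ℤ) : Submodule ZHalf (FKh O) :=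
  Submodule.span ZHalf
    {z | ∃ C : Cobordism O, C.euler = j ∧ z = Submodule.Quotient.mk (CobMor.of C)}

/-! ## Formal direct sums -/

/-- A finite formal direct sum of configurations of circles with shifted degrees: the sum of the
objects `circles x {shift x}` over the index set. -/
structure MatObj where
  /-- the index set of the summands -/
  index : Type
  finite_index : Finite index
  /-- the circles of a summand -/
  circles : index → Type
  /-- the degree shift of a summand -/
  shift : index → ℤ

/-- The formal direct sum of a finite family of objects. -/
def MatObj.sum {α : Type} [Finite α] (A : α → MatObj) : MatObj where
  index := Σ x, (A x).index
  finite_index := by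
    have := fun x => (A x).finite_index
    infer_instance
  circles := fun x => (A x.1).circles x.2
  shift := fun x => (A x.1).shift x.2

/-- The homogeneous component of degree `j` of the value of the Khovanov functor on a formal direct
sum. The shift `{m}` raises the degree by `m`. -/
noncomputable abbrev MatObj.FKhDegree (A : MatObj) (j : ℤ) : Type :=
  ⨁ x : A.index, FKh.degreePart (A.circles x) (j - A.shift x)

/-! ## The formal Khovanov bracket of a colored link -/

/-- A pairing of `n` dots on a line: a set of pairs of neighbouring dots such that each dot is in at
most one pair. A pair is given by its left dot. -/
abbrev DotPairing (n : ℕ) : Type :=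
  {s : Finset (Fin n) // (∀ a ∈ s, a.val + 1 < n) ∧ ∀ a ∈ s, ∀ b ∈ s, b.val ≠ a.val + 1}

namespace LinkDiagram

variable {ι X : Type}

/-- The chain object `Kh ^ r (D)` of the formal Khovanov bracket: the formal direct sum of the
smoothings of height `r + c₋`, shifted by `{r + c₊ - c₋}`. -/
def khChain [Fintype X] (D : LinkDiagram ι X) (r : ℤ) : MatObj where
  index := {s : X → Bool // (height s : ℤ) - D.nNeg = r}
  finite_index := inferInstance
  circles := fun s => D.Circles s.1
  shift := fun _ => r + D.nPos - D.nNeg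

/-- The chain object in bidegree `(i, r)` of the formal Khovanov bracket of `D` colored by `n`: the
formal direct sum of the objects `Kh ^ r (D ^ (n - 2 k))`, over all families of pairings of the dots
(`n x` dots for the component `x`) with `k x` pairs on the line of `x` and `i` pairs in total. -/
def coloredKhChain [Fintype ι] [Fintype X] (D : LinkDiagram ι X) (n : ι → ℕ)
    (i : ℕ) (r : ℤ) : MatObj :=
  MatObj.sum fun s : {s : (x : ι) → DotPairing (n x) // ∑ x, (s x).1.card = i} =>
    (D.cable fun x => n x - 2 * (s.1 x).1.card).khChain r

/-- The dimension of `M ^ (i, r, j) ⊗ ℚ`, where `M ^ (i, r, j)` is the homogeneous component of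
degree `j` of the value of the Khovanov functor on the chain object in bidegree `(i, r)`. -/
noncomputable def coloredKhDim [Fintype ι] [Fintype X] (D : LinkDiagram ι X) (n : ι → ℕ)
    (i : ℕ) (r j : ℤ) : ℕ :=
  Module.finrank ℚ (ℚ ⊗[ZHalf] (D.coloredKhChain n i r).FKhDegree j)

/-- The total graded Euler characteristic `∑ (-1) ^ (i + r) q ^ j dim (M ^ (i, r, j) ⊗ ℚ)`. -/
noncomputable def coloredKhEuler [Fintype ι] [Fintype X] (D : LinkDiagram ι X) (n : ι → ℕ) :
    ℤ[T;T⁻¹] :=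
  ∑ᶠ t : ℕ × ℤ × ℤ, LaurentPolynomial.C ((Int.negOnePow (t.1 + t.2.1) : ℤ) *
    (D.coloredKhDim n t.1 t.2.1 t.2.2 : ℤ)) * LaurentPolynomial.T t.2.2

end LinkDiagram

/-! ## Elementary facts on cobordisms -/

section CobordismBasics

variable {O : Type}

/-! Only the chain objects enter the Euler characteristic, so everything rests on the graded rank of
`FKh O` for a finite set `O` of circles. It is $(q+q^{-1})^{|O|}$: a basis is given by the surfaces
`discs S`, $S\subseteq O$, which cap the circles of $S$ with one-holed tori and the others with
discs, in degree $|O|-2|S|$.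

They span by neck cutting. The four tube relation with the discs 1, 3 on one component and 2, 4 on
another reads $2C=C_1+C_2$, where $C$ has a tube between the two components and $C_1$, $C_2$ have
instead a handle on one of them. As $2$ is invertible, every component can be cut until it has one
boundary circle, without a change of the Euler characteristic (`FKh.of_mem_span_discs`). They are
independent because the Frobenius algebra $\mathbb Z[1/2][x]/(x^2)$ gives an evaluation that
respects all relations and sends `discs S` to $2^{|S|}\prod_{b\in S}x_b$
(`linearIndependent_discs`).

Hence the dimension in tridegree $(i,r,j)$ counts triples of a family of pairings, a smoothing of
the remaining cable and a set of marked circles (`coloredKhDim_eq`), and $\chi$ is a signed sum over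
all triples. Summing over the marked sets gives $(q+q^{-1})^{o(s)}$, summing over the smoothings
gives the Jones polynomial of the cable (`jones_eq_sum`), and summing over the pairings gives the
binomial coefficients, as $n$ dots have $\binom{n-k}{k}$ pairings with $k$ pairs
(`card_dotPairing`). -/

open Classical in
theorem IsCobordism.exists_filter_eq {C : Multiset (SurfaceComponent O)} (h : IsCobordism C)
    (x : O) : ∃ a, C.filter (fun c => x ∈ c.boundary) = {a} := by
  have hx := h x
  rw [Multiset.countP_eq_card_filter] at hx
  exact Multiset.card_eq_one.1 hx

theorem IsCobordism.exists_mem {C : Multiset (SurfaceComponent O)} (h : IsCobordism C) (x : O) :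
    ∃ c ∈ C, x ∈ c.boundary := by
  classical
  obtain ⟨a, ha⟩ := h.exists_filter_eq x
  have : a ∈ C.filter (fun c => x ∈ c.boundary) := by simp [ha]
  exact ⟨a, Multiset.mem_of_mem_filter this, (Multiset.mem_filter.1 this).2⟩

theorem IsCobordism.eq_of_mem {C : Multiset (SurfaceComponent O)} (h : IsCobordism C) {x : O}
    {c c' : SurfaceComponent O} (hc : c ∈ C) (hc' : c' ∈ C) (hx : x ∈ c.boundary)
    (hx' : x ∈ c'.boundary) : c = c' := by
  classical
  obtain ⟨a, ha⟩ := h.exists_filter_eq x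
  have h1 : c ∈ C.filter (fun c => x ∈ c.boundary) := Multiset.mem_filter.2 ⟨hc, hx⟩
  have h2 : c' ∈ C.filter (fun c => x ∈ c.boundary) := Multiset.mem_filter.2 ⟨hc', hx'⟩
  rw [ha, Multiset.mem_singleton] at h1 h2
  rw [h1, h2]

/-- A repeated component would contain each of its boundary circles twice; only closed components
can occur more than once. -/
theorem IsCobordism.nodup {C : Multiset (SurfaceComponent O)} (h : IsCobordism C)
    (hne : ∀ c ∈ C, c.boundary.Nonempty) : C.Nodup := by
  classical
  rw [Multiset.nodup_iff_count_le_one]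
  intro c
  by_cases hc : c ∈ C
  · obtain ⟨x, hx⟩ := hne c hc
    obtain ⟨a, ha⟩ := h.exists_filter_eq x
    rw [← Multiset.count_filter_of_pos (p := fun c => x ∈ c.boundary) hx, ha]
    exact (Multiset.count_le_card _ _).trans (by simp)
  · simp [Multiset.count_eq_zero_of_notMem hc]

theorem IsCobordism.disjoint_boundary {k : ℕ} {comp : Fin k → SurfaceComponent O}
    (h : IsCobordism (Finset.univ.val.map comp)) {a b : Fin k} (hab : a ≠ b) :
    Disjoint (comp a).boundary (comp b).boundary := by
  classical
  rw [Finset.disjoint_left]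
  intro x hxa hxb
  have hx := h x
  rw [Multiset.countP_map, ← Finset.filter_val, Finset.card_val] at hx
  obtain ⟨c, hc⟩ := Finset.card_eq_one.1 hx
  have h1 : a ∈ Finset.univ.filter (fun i => x ∈ (comp i).boundary) := by simpa using hxa
  have h2 : b ∈ Finset.univ.filter (fun i => x ∈ (comp i).boundary) := by simpa using hxb
  rw [hc, Finset.mem_singleton] at h1 h2
  exact hab (h1.trans h2.symm)

theorem cons_cons_map_sdiff_pair {α : Type} {k : ℕ} (f : Fin k → α) {a b : Fin k} (hab : a ≠ b) :
    f a ::ₘ f b ::ₘ ((Finset.univ : Finset (Fin k)) \ {a, b}).val.map f =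
      Finset.univ.val.map f := by
  have h : (Finset.univ : Finset (Fin k)) =
      Finset.cons a (Finset.cons b (Finset.univ \ {a, b}) (by simp)) (by simp [hab]) := by
    ext x
    simp only [Finset.mem_univ, Finset.mem_cons, Finset.mem_sdiff, Finset.mem_insert,
      Finset.mem_singleton, true_and, true_iff]
    tauto
  conv_rhs => rw [h]
  simp only [Finset.cons_val, Multiset.map_cons]

theorem cons_map_sdiff_singleton {α : Type} {k : ℕ} (f : Fin k → α) (a : Fin k) :
    f a ::ₘ ((Finset.univ : Finset (Fin k)) \ {a}).val.map f = Finset.univ.val.map f := by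
  have h : (Finset.univ : Finset (Fin k)) =
      Finset.cons a (Finset.univ \ {a}) (by simp) := by
    ext x
    simp only [Finset.mem_univ, Finset.mem_cons, Finset.mem_sdiff,
      Finset.mem_singleton, true_and, true_iff]
    tauto
  conv_rhs => rw [h]
  simp only [Finset.cons_val, Multiset.map_cons]

open Classical in
theorem tube_of_ne {k : ℕ} (comp : Fin k → SurfaceComponent O) {a b : Fin k} (hab : a ≠ b)
    {R : Multiset (SurfaceComponent O)}
    (h : Finset.univ.val.map comp = comp a ::ₘ comp b ::ₘ R) :
    tube comp a b =
      ⟨(comp a).boundary ∪ (comp b).boundary, (comp a).genus + (comp b).genus⟩ ::ₘ R := by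
  rw [← cons_cons_map_sdiff_pair comp hab, Multiset.cons_inj_right, Multiset.cons_inj_right] at h
  rw [tube, if_neg hab, h]

theorem tube_self {k : ℕ} (comp : Fin k → SurfaceComponent O) (a : Fin k)
    {R : Multiset (SurfaceComponent O)} (h : Finset.univ.val.map comp = comp a ::ₘ R) :
    tube comp a a = ⟨(comp a).boundary, (comp a).genus + 1⟩ ::ₘ R := by
  rw [← cons_map_sdiff_singleton comp a, Multiset.cons_inj_right] at h
  rw [tube, if_pos rfl, Finset.pair_eq_singleton, h]

end CobordismBasics

/-! ## The evaluation of cobordisms by the Frobenius algebra `ℤ[1/2][x] / (x ^ 2)` -/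

section Evaluation

open Classical MvPolynomial

variable {O : Type}

/-- The value of a connected surface with a dot. -/
noncomputable def SurfaceComponent.dotValue (c : SurfaceComponent O) : MvPolynomial O ZHalf :=
  if c.genus = 0 then ∏ b ∈ c.boundary, X b else 0

/-- The value of a connected surface: the element of the tensor power of `ℤ[1/2][x] / (x ^ 2)`
indexed by the boundary, written as a multilinear polynomial. -/
noncomputable def SurfaceComponent.value (c : SurfaceComponent O) : MvPolynomial O ZHalf :=
  if c.genus = 0 then ∑ b ∈ c.boundary, ∏ b' ∈ c.boundary.erase b, X b'
  else if c.genus = 1 then 2 * ∏ b ∈ c.boundary, X b else 0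

theorem SurfaceComponent.value_handle (c : SurfaceComponent O) :
    SurfaceComponent.value ⟨c.boundary, c.genus + 1⟩ = 2 * c.dotValue := by
  rcases c with ⟨B, g⟩
  rcases g with _ | g <;> simp [SurfaceComponent.value, SurfaceComponent.dotValue]

/-- This is neck cutting in the Frobenius algebra, $\Delta(1)=x\otimes1+1\otimes x$. The boundaries
being disjoint, no variable is ever squared, so the relation $x^2=0$ need not be imposed on the
polynomials. -/
theorem SurfaceComponent.value_union (c c' : SurfaceComponent O)
    (h : Disjoint c.boundary c'.boundary) :
    SurfaceComponent.value ⟨c.boundary ∪ c'.boundary, c.genus + c'.genus⟩ =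
      c.dotValue * c'.value + c.value * c'.dotValue := by
  rcases c with ⟨B, g⟩
  rcases c' with ⟨B', g'⟩
  dsimp only at h ⊢
  rcases g with _ | _ | g <;> rcases g' with _ | _ | g'
  · simp only [SurfaceComponent.value, SurfaceComponent.dotValue, if_true, add_zero]
    -- In genus 0 the formula is a Leibniz rule: the one omitted variable belongs to `B'` or to `B`.
    rw [Finset.sum_union h, add_comm, Finset.mul_sum, Finset.sum_mul]
    congr 1
    · refine Finset.sum_congr rfl fun b hb => ?_
      have hb' : b ∉ B := fun hB => Finset.disjoint_left.1 h hB hb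
      rw [Finset.erase_union_distrib, Finset.erase_eq_of_notMem hb',
        Finset.prod_union (h.mono_right (Finset.erase_subset _ _))]
    · refine Finset.sum_congr rfl fun b hb => ?_
      have hb' : b ∉ B' := fun hB => Finset.disjoint_left.1 h hb hB
      rw [Finset.erase_union_distrib, Finset.erase_eq_of_notMem hb',
        Finset.prod_union (h.mono_left (Finset.erase_subset _ _))]
  · simp [SurfaceComponent.value, SurfaceComponent.dotValue, Finset.prod_union h]; ring
  · simp [SurfaceComponent.value, SurfaceComponent.dotValue]
  · simp [SurfaceComponent.value, SurfaceComponent.dotValue, Finset.prod_union h]; ring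
  · simp [SurfaceComponent.value, SurfaceComponent.dotValue]
  · simp [SurfaceComponent.value, SurfaceComponent.dotValue]
  · simp [SurfaceComponent.value, SurfaceComponent.dotValue]
  · have : g + 1 + 1 + (0 + 1) ≠ 1 := by omega
    simp [SurfaceComponent.value, SurfaceComponent.dotValue]
  · have : g + 1 + 1 + (g' + 1 + 1) ≠ 1 := by omega
    simp [SurfaceComponent.value, SurfaceComponent.dotValue, this]

/-- The value of a surface: the product of the values of its components. -/
noncomputable def surfaceValue (C : Multiset (SurfaceComponent O)) : MvPolynomial O ZHalf :=
  (C.map SurfaceComponent.value).prod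

@[simp]
theorem surfaceValue_cons (c : SurfaceComponent O) (C : Multiset (SurfaceComponent O)) :
    surfaceValue (c ::ₘ C) = c.value * surfaceValue C := by
  simp [surfaceValue]

/-- A tube has the value of the sum of the two ways to put a dot on one of its ends. -/
theorem surfaceValue_tube {k : ℕ} {comp : Fin k → SurfaceComponent O}
    (h : IsCobordism (Finset.univ.val.map comp)) (a b : Fin k) :
    surfaceValue (tube comp a b) =
      (comp a).dotValue * surfaceValue (((Finset.univ : Finset (Fin k)) \ {a}).val.map comp) +
      (comp b).dotValue * surfaceValue (((Finset.univ : Finset (Fin k)) \ {b}).val.map comp) := by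
  by_cases hab : a = b
  · subst hab
    rw [tube_self comp a (cons_map_sdiff_singleton comp a).symm, surfaceValue_cons,
      SurfaceComponent.value_handle]
    ring
  · have h1 := cons_cons_map_sdiff_pair comp hab
    have ha : ((Finset.univ : Finset (Fin k)) \ {a}).val.map comp =
        comp b ::ₘ ((Finset.univ : Finset (Fin k)) \ {a, b}).val.map comp := by
      rw [← cons_map_sdiff_singleton comp a, Multiset.cons_inj_right] at h1
      exact h1.symm
    have hb : ((Finset.univ : Finset (Fin k)) \ {b}).val.map comp =
        comp a ::ₘ ((Finset.univ : Finset (Fin k)) \ {a, b}).val.map comp := by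
      rw [← cons_map_sdiff_singleton comp b, Multiset.cons_swap, Multiset.cons_inj_right] at h1
      exact h1.symm
    rw [tube_of_ne comp hab (cons_cons_map_sdiff_pair comp hab).symm, ha, hb]
    simp only [surfaceValue_cons]
    rw [SurfaceComponent.value_union _ _ (h.disjoint_boundary hab)]
    ring

/-- The evaluation on formal linear combinations of cobordisms. -/
noncomputable def evalFinsupp (O : Type) : (Cobordism O →₀ ZHalf) →ₗ[ZHalf] MvPolynomial O ZHalf :=
  Finsupp.linearCombination ZHalf fun C => surfaceValue C.1

theorem evalFinsupp_single (C : Cobordism O) (r : ZHalf) :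
    evalFinsupp O (Finsupp.single C r) = r • surfaceValue C.1 := by
  simp [evalFinsupp, Finsupp.linearCombination_single]

theorem evalFinsupp_relator {z : Cobordism O →₀ ZHalf} (hz : IsLocalRelator z) :
    evalFinsupp O z = 0 := by
  cases hz with
  | sphere C hC =>
    obtain ⟨R, hR⟩ := Multiset.exists_cons_of_mem hC
    rw [evalFinsupp_single, hR, surfaceValue_cons]
    -- The sphere is an empty sum; for the torus below, the empty product leaves the factor 2.
    simp [SurfaceComponent.value]
  | torus C C' hC =>
    rw [map_sub, evalFinsupp_single, evalFinsupp_single, hC, surfaceValue_cons, one_smul,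
      ofNat_smul_eq_nsmul]
    simp [SurfaceComponent.value, two_mul]
  | fourTube comp h a =>
    -- A tube between $a$ and $b$ has a value of the form $f(a)+f(b)$, so both sides of the relation
    -- become the sum of $f$ over the four discs.
    simp only [map_sub, map_add, evalFinsupp_single, one_smul, surfaceValue_tube h]
    ring

/-- The evaluation on the morphisms from the empty set. -/
noncomputable def evalCobMor (O : Type) : CobMor O →ₗ[ZHalf] MvPolynomial O ZHalf :=
  Submodule.liftQ _ (evalFinsupp O) (Submodule.span_le.2 fun _ hz => evalFinsupp_relator hz)

theorem evalCobMor_of (C : Cobordism O) : evalCobMor O (CobMor.of C) = surfaceValue C.1 := by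
  rw [evalCobMor, CobMor.of, Submodule.liftQ_apply, evalFinsupp_single, one_smul]

/-- The class of a cobordism in `FKh`. -/
noncomputable def FKh.of (C : Cobordism O) : FKh O := Submodule.Quotient.mk (CobMor.of C)

theorem surfaceValue_of_one_lt_genus {C : Multiset (SurfaceComponent O)}
    (h : ∃ c ∈ C, 1 < c.genus) : surfaceValue C = 0 := by
  obtain ⟨c, hc, hg⟩ := h
  obtain ⟨R, rfl⟩ := Multiset.exists_cons_of_mem hc
  have h0 : c.genus ≠ 0 := by omega
  have h1 : c.genus ≠ 1 := by omega
  simp [SurfaceComponent.value, h0, h1]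

/-- The evaluation on the value of the Khovanov functor. -/
noncomputable def FKh.eval (O : Type) : FKh O →ₗ[ZHalf] MvPolynomial O ZHalf :=
  Submodule.liftQ _ (evalCobMor O) (Submodule.span_le.2 (by
    rintro _ ⟨C, hC, rfl⟩
    rw [SetLike.mem_coe, LinearMap.mem_ker, evalCobMor_of, surfaceValue_of_one_lt_genus hC]))

theorem FKh.eval_of (C : Cobordism O) : FKh.eval O (FKh.of C) = surfaceValue C.1 := by
  rw [FKh.eval, FKh.of, Submodule.liftQ_apply, evalCobMor_of]

end Evaluation

/-! ## The basis of dotted discs -/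

section Basis

open Classical

variable {O : Type}

/-- One half, as an element of `ℤ[1/2]`. -/
def ZHalf.half : ZHalf := ⟨1 / 2, Algebra.subset_adjoin rfl⟩

theorem ZHalf.half_mul_two : ZHalf.half * 2 = 1 := Subtype.ext (by
  change (1 / 2 : ℚ) * 2 = 1
  norm_num)

/-- The cobordism made of a disc for each circle outside of `S` and of a one-holed torus for each
circle in `S`. -/
noncomputable def discs [Fintype O] (S : Finset O) : Cobordism O :=
  ⟨Finset.univ.val.map fun b => ⟨{b}, if b ∈ S then 1 else 0⟩, fun x => by
    rw [Multiset.countP_map, ← Finset.filter_val, Finset.card_val]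
    simp [Finset.filter_eq]⟩

/-- A disc has Euler characteristic 1 and a one-holed torus has $-1$. -/
theorem euler_discs [Fintype O] (S : Finset O) :
    (discs S).euler = Fintype.card O - 2 * S.card := by
  simp only [Cobordism.euler, discs, Multiset.map_map, Function.comp_def, SurfaceComponent.euler]
  change ∑ b : O, _ = _
  simp only [Finset.card_singleton, Nat.cast_ite, Nat.cast_one, Nat.cast_zero, mul_ite, mul_one,
    mul_zero, Finset.sum_sub_distrib, Finset.sum_ite_mem, Finset.univ_inter, Finset.sum_const,
    Finset.card_univ, nsmul_eq_mul]
  ring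

theorem surfaceValue_discs [Fintype O] (S : Finset O) :
    surfaceValue (discs S).1 = MvPolynomial.monomial (∑ b ∈ S, Finsupp.single b 1) (2 ^ S.card) := by
  have h : surfaceValue (discs S).1 = ∏ b ∈ S, (2 * MvPolynomial.X b) := by
    simp only [surfaceValue, discs, Multiset.map_map, Function.comp_def]
    change ∏ b : O, _ = _
    rw [← Finset.prod_subset (Finset.subset_univ S)]
    · refine Finset.prod_congr rfl fun b hb => ?_
      simp [SurfaceComponent.value, hb]
    · intro b _ hb
      simp [SurfaceComponent.value, hb]
  rw [h, Finset.prod_mul_distrib, Finset.prod_const, MvPolynomial.monomial_eq]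
  congr 1
  · rw [map_pow, map_ofNat]
  · rw [Finsupp.prod_of_support_subset _ (s := S)]
    · refine Finset.prod_congr rfl fun b hb => ?_
      simp [Finsupp.finsetSum_apply, Finsupp.single_apply, hb]
    · intro b hb
      by_contra hbS
      simp [Finsupp.finsetSum_apply, Finsupp.single_apply, hbS] at hb
    · simp

/-- The evaluation sends the family to distinct squarefree monomials, up to the factors $2^{|S|}$,
which are units. -/
theorem linearIndependent_discs [Fintype O] :
    LinearIndependent ZHalf fun S : Finset O => FKh.of (discs S) := by
  refine LinearIndependent.of_comp (FKh.eval O) ?_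
  have hinj : Function.Injective fun S : Finset O => ∑ b ∈ S, Finsupp.single b 1 := by
    intro S S' h
    ext b
    have := DFunLike.congr_fun h b
    simp only [Finsupp.finsetSum_apply, Finsupp.single_apply, Finset.sum_ite_eq'] at this
    by_cases h1 : b ∈ S <;> by_cases h2 : b ∈ S' <;> simp_all
  let u : ZHalfˣ := ⟨2, ZHalf.half, by rw [mul_comm]; exact ZHalf.half_mul_two,
    ZHalf.half_mul_two⟩
  have h := ((MvPolynomial.basisMonomials O ZHalf).linearIndependent.comp _ hinj).units_smul
    fun S => u ^ S.card
  convert h using 1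
  · ext1 S
    simp only [Function.comp_apply, FKh.eval_of, surfaceValue_discs, Pi.smul_apply',
      MvPolynomial.coe_basisMonomials]
    rw [Units.smul_def, MvPolynomial.smul_monomial]
    simp [u]
  · rfl
  · rfl

/-! ### Reduction of cobordisms to discs and one-holed tori. -/

theorem FKh.of_eq_zero_of_one_lt_genus {C : Cobordism O} (h : ∃ c ∈ C.1, 1 < c.genus) :
    FKh.of C = 0 :=
  (Submodule.Quotient.mk_eq_zero _).2 (Submodule.subset_span ⟨C, h, rfl⟩)

/-- The quotient map from formal linear combinations of cobordisms. -/
noncomputable def FKh.mk (O : Type) : (Cobordism O →₀ ZHalf) →ₗ[ZHalf] FKh O :=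
  (Submodule.mkQ _).comp (Submodule.mkQ _)

theorem FKh.mk_single (C : Cobordism O) (r : ZHalf) :
    FKh.mk O (Finsupp.single C r) = r • FKh.of C := by
  rw [← mul_one r, ← smul_eq_mul, ← Finsupp.smul_single, map_smul]
  simp only [smul_eq_mul, mul_one]
  rfl

theorem FKh.mk_relator {z : Cobordism O →₀ ZHalf} (hz : IsLocalRelator z) : FKh.mk O z = 0 := by
  have h : (Submodule.Quotient.mk z : CobMor O) = 0 :=
    (Submodule.Quotient.mk_eq_zero _).2 (Submodule.subset_span hz)
  rw [FKh.mk, LinearMap.comp_apply, Submodule.mkQ_apply, Submodule.mkQ_apply, h,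
    Submodule.Quotient.mk_zero]

theorem FKh.of_sphere {C : Cobordism O} (h : ⟨∅, 0⟩ ∈ C.1) : FKh.of C = 0 := by
  have := FKh.mk_relator (IsLocalRelator.sphere C h)
  rwa [FKh.mk_single, one_smul] at this

theorem FKh.of_torus {C C' : Cobordism O} (h : C.1 = ⟨∅, 1⟩ ::ₘ C'.1) :
    FKh.of C = (2 : ZHalf) • FKh.of C' := by
  have := FKh.mk_relator (IsLocalRelator.torus C C' h)
  rwa [map_sub, FKh.mk_single, FKh.mk_single, one_smul, sub_eq_zero] at this

/-- The neck cutting relation. -/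
theorem FKh.of_union {C C₁ C₂ : Cobordism O} {c c' : SurfaceComponent O}
    {R : Multiset (SurfaceComponent O)} (h₀ : IsCobordism (c ::ₘ c' ::ₘ R))
    (h : C.1 = ⟨c.boundary ∪ c'.boundary, c.genus + c'.genus⟩ ::ₘ R)
    (h₁ : C₁.1 = ⟨c.boundary, c.genus + 1⟩ ::ₘ c' ::ₘ R)
    (h₂ : C₂.1 = c ::ₘ ⟨c'.boundary, c'.genus + 1⟩ ::ₘ R) :
    FKh.of C = ZHalf.half • (FKh.of C₁ + FKh.of C₂) := by
  obtain ⟨l, rfl⟩ : ∃ l : List (SurfaceComponent O), R = l := ⟨R.toList, R.coe_toList.symm⟩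
  let comp : Fin (l.length + 2) → SurfaceComponent O := (c :: c' :: l).get
  have hmap : Finset.univ.val.map comp = c ::ₘ c' ::ₘ (l : Multiset _) := by
    rw [Fin.univ_val_map]
    exact congrArg _ (List.ofFn_get (c :: c' :: l))
  have hcob : IsCobordism (Finset.univ.val.map comp) := by rw [hmap]; exact h₀
  have h01 : (0 : Fin (l.length + 2)) ≠ 1 := by simp
  have t1 : tube comp 0 1 = C.1 := by rw [h]; exact tube_of_ne comp h01 hmap
  have t2 : tube comp 0 0 = C₁.1 := by rw [h₁]; exact tube_self comp 0 hmap
  have t3 : tube comp 1 1 = C₂.1 := by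
    rw [h₂, Multiset.cons_swap]
    exact tube_self comp 1 (hmap.trans (Multiset.cons_swap _ _ _))
  -- With this choice $C_{12}$ and $C_{34}$ both equal `C`, while $C_{13}$ and $C_{24}$ add a handle
  -- to the first or to the second component.
  have key := FKh.mk_relator (IsLocalRelator.fourTube comp hcob ![0, 1, 0, 1])
  simp only [Matrix.cons_val, t1, t2, t3, map_sub, map_add, FKh.mk_single, one_smul,
    Subtype.coe_eta] at key
  have h2 : (2 : ZHalf) • FKh.of C = FKh.of C₁ + FKh.of C₂ := by
    rw [two_smul, ← sub_eq_zero, ← key]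
    abel
  rw [← h2, smul_smul, ZHalf.half_mul_two, one_smul]

/-- The number of steps that are needed to cut a surface into discs and one-holed tori. -/
noncomputable def cutComplexity (C : Multiset (SurfaceComponent O)) : ℕ :=
  (C.map fun c => if c.boundary = ∅ then 1 else c.boundary.card - 1).sum

theorem Cobordism.eq_discs [Fintype O] (C : Cobordism O) (hg : ∀ c ∈ C.1, c.genus ≤ 1)
    (hB : ∀ c ∈ C.1, c.boundary.card = 1) :
    C = discs (Finset.univ.filter fun b => ⟨{b}, 1⟩ ∈ C.1) := by
  have hne : ∀ (C : Cobordism O), (∀ c ∈ C.1, c.boundary.card = 1) →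
      ∀ c ∈ C.1, c.boundary.Nonempty := fun C h c hc => by
    rw [← Finset.card_pos, h c hc]
    exact one_pos
  refine Subtype.ext ((Multiset.Nodup.ext (C.2.nodup (hne C hB))
    ((discs _).2.nodup (hne _ ?_))).2 fun c => ?_)
  · intro c hc
    obtain ⟨b, -, rfl⟩ := Multiset.mem_map.1 hc
    simp
  · simp only [discs, Multiset.mem_map, Finset.mem_val, Finset.mem_univ, true_and,
      Finset.mem_filter]
    constructor
    · intro hc
      obtain ⟨b, hb⟩ := Finset.card_eq_one.1 (hB c hc)
      refine ⟨b, ?_⟩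
      have hg' := hg c hc
      obtain ⟨B, g⟩ := c
      dsimp only at hb hg'
      subst hb
      congr 1
      split_ifs with h
      · exact congrArg SurfaceComponent.genus
          (C.2.eq_of_mem h hc (Finset.mem_singleton_self b) (Finset.mem_singleton_self b))
      · interval_cases g
        · rfl
        · exact absurd hc h
    · rintro ⟨b, rfl⟩
      split_ifs with h
      · exact h
      · obtain ⟨c, hc, hbc⟩ := C.2.exists_mem b
        obtain ⟨b', hb'⟩ := Finset.card_eq_one.1 (hB c hc)
        have hg' := hg c hc
        obtain ⟨B, g⟩ := c
        dsimp only at hb' hg' hbc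
        subst hb'
        obtain rfl := Finset.mem_singleton.1 hbc
        interval_cases g
        · exact hc
        · exact absurd hc h

/-- Induction on `cutComplexity`: genus above 1 and spheres give zero, a closed torus gives a factor
2, and a component with several boundary circles is cut along a neck that separates one of them.
Every step that does not give zero preserves the Euler characteristic, so the span stays in one
degree. -/
theorem FKh.of_mem_span_discs [Fintype O] (C : Cobordism O) :
    FKh.of C ∈ Submodule.span ZHalf
      {z | ∃ S : Finset O, (discs S).euler = C.euler ∧ z = FKh.of (discs S)} := by
  induction hn : cutComplexity C.1 using Nat.strong_induction_on generalizing C with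
  | _ n ih =>
  subst hn
  by_cases hg : ∃ c ∈ C.1, 1 < c.genus
  · rw [FKh.of_eq_zero_of_one_lt_genus hg]
    exact Submodule.zero_mem _
  push Not at hg
  by_cases hclosed : ∃ c ∈ C.1, c.boundary = ∅
  · obtain ⟨⟨B, g⟩, hc, hB⟩ := hclosed
    have hg' := hg _ hc
    dsimp only at hB hg'
    subst hB
    interval_cases g
    · rw [FKh.of_sphere hc]
      exact Submodule.zero_mem _
    · obtain ⟨R, hR⟩ := Multiset.exists_cons_of_mem hc
      have hRc : IsCobordism R := fun x => by
        have := C.2 x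
        rwa [hR, Multiset.countP_cons_of_neg _ (by simp)] at this
      have he : C.euler = Cobordism.euler ⟨R, hRc⟩ := by
        simp [Cobordism.euler, hR, SurfaceComponent.euler]
      rw [FKh.of_torus (C' := ⟨R, hRc⟩) hR, he]
      refine Submodule.smul_mem _ _ (ih _ ?_ ⟨R, hRc⟩ rfl)
      simp [hR, cutComplexity]
  push Not at hclosed
  by_cases hcut : ∃ c ∈ C.1, c.boundary.card ≠ 1
  · obtain ⟨⟨B, g⟩, hc, hB⟩ := hcut
    have hne := hclosed _ hc
    dsimp only at hB hne
    have hne₀ : B ≠ ∅ := hne.ne_empty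
    obtain ⟨b, hb⟩ := hne
    obtain ⟨R, hR⟩ := Multiset.exists_cons_of_mem hc
    have hcard : (B.erase b).card + 1 = B.card := Finset.card_erase_add_one hb
    have hne' : B.erase b ≠ ∅ := by
      intro h0
      rw [h0, Finset.card_empty] at hcard
      exact hB hcard.symm
    have hpos : 0 < (B.erase b).card := Finset.card_pos.2 (Finset.nonempty_iff_ne_empty.2 hne')
    have hcob : ∀ g₁ g₂ : ℕ, IsCobordism
        ((⟨{b}, g₁⟩ : SurfaceComponent O) ::ₘ ⟨B.erase b, g₂⟩ ::ₘ R) := by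
      intro g₁ g₂ x
      have hx := C.2 x
      simp only [hR, Multiset.countP_cons, Finset.mem_singleton, Finset.mem_erase] at hx ⊢
      by_cases h1 : x = b
      · subst h1
        simpa [hb] using hx
      · simpa [h1] using hx
    have hcut := FKh.of_union (C := C) (C₁ := ⟨_, hcob 1 g⟩) (C₂ := ⟨_, hcob 0 (g + 1)⟩)
      (c := ⟨{b}, 0⟩) (c' := ⟨B.erase b, g⟩) (hcob 0 g)
      (by rw [hR]; simp [Finset.insert_erase hb]) rfl rfl
    -- The extra component contributes $+2$, the extra handle $-2$. A genus that has grown to 2 is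
    -- harmless, since such a term vanishes in the next round.
    have he : ∀ g₁ g₂ : ℕ, g₁ + g₂ = g + 1 → C.euler = Cobordism.euler ⟨_, hcob g₁ g₂⟩ := by
      intro g₁ g₂ h
      simp only [Cobordism.euler, hR, SurfaceComponent.euler, Multiset.map_cons,
        Multiset.sum_cons, Finset.card_singleton]
      rw [← hcard]
      have h' : (g₁ : ℤ) + g₂ = g + 1 := by exact_mod_cast h
      push_cast
      linarith
    have hm : ∀ g₁ g₂ : ℕ, cutComplexity
        ((⟨{b}, g₁⟩ : SurfaceComponent O) ::ₘ ⟨B.erase b, g₂⟩ ::ₘ R) < cutComplexity C.1 := by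
      intro g₁ g₂
      simp only [cutComplexity, hR, Multiset.map_cons, Multiset.sum_cons, hne₀, hne',
        Finset.singleton_ne_empty, Finset.card_singleton, if_false]
      omega
    rw [hcut]
    refine Submodule.smul_mem _ _ (Submodule.add_mem _ ?_ ?_)
    · rw [he 1 g (add_comm _ _)]
      exact ih _ (hm 1 g) _ rfl
    · rw [he 0 (g + 1) (zero_add _)]
      exact ih _ (hm 0 (g + 1)) _ rfl
  · push Not at hcut
    have hC := C.eq_discs hg hcut
    refine Submodule.subset_span ⟨_, congrArg Cobordism.euler hC.symm, congrArg FKh.of hC⟩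

theorem FKh.degreePart_eq_span_discs [Fintype O] (j : ℤ) :
    FKh.degreePart O j = Submodule.span ZHalf (Set.range
      fun S : {S : Finset O // (Fintype.card O : ℤ) - 2 * S.card = j} => FKh.of (discs S.1)) := by
  refine le_antisymm (Submodule.span_le.2 ?_) (Submodule.span_le.2 ?_)
  · rintro _ ⟨C, rfl, rfl⟩
    refine Submodule.span_mono ?_ (FKh.of_mem_span_discs C)
    rintro _ ⟨S, hS, rfl⟩
    exact ⟨⟨S, by rw [← euler_discs, hS]⟩, rfl⟩
  · rintro _ ⟨⟨S, hS⟩, rfl⟩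
    exact Submodule.subset_span ⟨discs S, by rw [euler_discs, hS], rfl⟩

/-- The basis of the homogeneous component of degree `j` which is given by the cobordisms made of
discs and one-holed tori. -/
noncomputable def FKh.degreePartBasis (O : Type) [Fintype O] (j : ℤ) :
    Module.Basis {S : Finset O // (Fintype.card O : ℤ) - 2 * S.card = j} ZHalf
      (FKh.degreePart O j) :=
  (Module.Basis.span (linearIndependent_discs.comp _ Subtype.val_injective)).map
    (LinearEquiv.ofEq _ _ (FKh.degreePart_eq_span_discs j).symm)

end Basis

/-! ## Dimensions of formal direct sums -/

section Dimension

variable (A : MatObj)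

instance FKh.free_degreePart (O : Type) [Finite O] (j : ℤ) :
    Module.Free ZHalf (FKh.degreePart O j) := by
  have := Fintype.ofFinite O
  exact Module.Free.of_basis (FKh.degreePartBasis O j)

instance FKh.finite_degreePart (O : Type) [Finite O] (j : ℤ) :
    Module.Finite ZHalf (FKh.degreePart O j) := by
  have := Fintype.ofFinite O
  exact Module.Finite.of_basis (FKh.degreePartBasis O j)

theorem FKh.finrank_degreePart (O : Type) (j : ℤ) [Finite O] :
    Module.finrank ZHalf (FKh.degreePart O j) =
      Nat.card {S : Finset O // (Nat.card O : ℤ) - 2 * S.card = j} := by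
  have := Fintype.ofFinite O
  rw [Module.finrank_eq_nat_card_basis (FKh.degreePartBasis O j)]
  simp only [Nat.card_eq_fintype_card]

set_option synthInstance.maxHeartbeats 400000 in
theorem MatObj.finite_FKhDegree (h : ∀ x, Finite (A.circles x)) (j : ℤ) :
    Module.Finite ZHalf (A.FKhDegree j) := by
  have := A.finite_index
  infer_instance

-- The graded pieces are free over $\mathbb Z[1/2]$, so passing to $\mathbb Q$ keeps their rank,
-- which is read off from the basis of discs and one-holed tori.
set_option synthInstance.maxHeartbeats 400000 in
theorem MatObj.finrank_FKhDegree (h : ∀ x, Finite (A.circles x)) (j : ℤ) :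
    Module.finrank ℚ (ℚ ⊗[ZHalf] A.FKhDegree j) =
      Nat.card (Σ x : A.index, {S : Finset (A.circles x) //
        A.shift x + Nat.card (A.circles x) - 2 * S.card = j}) := by
  have := A.finite_index
  have := Fintype.ofFinite A.index
  rw [Module.finrank_baseChange, Module.finrank_directSum, Nat.card_sigma]
  refine Finset.sum_congr rfl fun x _ => ?_
  rw [FKh.finrank_degreePart]
  refine Nat.card_congr (Equiv.subtypeEquivRight fun S => ?_)
  constructor <;> intro h <;> linarith

end Dimension

/-! ## Counting pairings of dots -/

/-- The sets of left dots of the pairings of `n` dots with `k` pairs. -/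
def leftDots (n k : ℕ) : Finset (Finset ℕ) :=
  ((Finset.range n).powersetCard k).filter fun s => ∀ a ∈ s, a + 1 < n ∧ a + 1 ∉ s

theorem mem_leftDots {n k : ℕ} {s : Finset ℕ} :
    s ∈ leftDots n k ↔ s.card = k ∧ ∀ a ∈ s, a + 1 < n ∧ a + 1 ∉ s := by
  simp only [leftDots, Finset.mem_filter, Finset.mem_powersetCard]
  constructor
  · rintro ⟨⟨-, h⟩, h'⟩
    exact ⟨h, h'⟩
  · rintro ⟨h, h'⟩
    exact ⟨⟨fun a ha => Finset.mem_range.2 (by have := (h' a ha).1; omega), h⟩, h'⟩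

/-- The split is by whether the last two dots `n`, `n + 1` form a pair; if they do, the other pairs
lie among the first `n` dots. -/
theorem leftDots_succ (n k : ℕ) :
    leftDots (n + 2) (k + 1) =
      leftDots (n + 1) (k + 1) ∪ (leftDots n k).image (insert n) := by
  ext s
  simp only [Finset.mem_union, Finset.mem_image, mem_leftDots]
  constructor
  · rintro ⟨hc, h⟩
    by_cases hn : n ∈ s
    · refine Or.inr ⟨s.erase n, ⟨by rw [Finset.card_erase_of_mem hn, hc, Nat.add_sub_cancel],
        fun a ha => ?_⟩, Finset.insert_erase hn⟩
      obtain ⟨hne, ha⟩ := Finset.mem_erase.1 ha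
      obtain ⟨h1, h2⟩ := h a ha
      have : a + 1 ≠ n := fun h0 => h2 (h0 ▸ hn)
      exact ⟨by omega, fun h0 => h2 (Finset.mem_of_mem_erase h0)⟩
    · refine Or.inl ⟨hc, fun a ha => ⟨?_, (h a ha).2⟩⟩
      have h1 := (h a ha).1
      have : a ≠ n := fun h0 => hn (h0 ▸ ha)
      omega
  · rintro (⟨hc, h⟩ | ⟨s, ⟨hc, h⟩, rfl⟩)
    · exact ⟨hc, fun a ha => ⟨(h a ha).1.trans (Nat.lt_succ_self _), (h a ha).2⟩⟩
    · have hn : n ∉ s := fun hn => by have := (h n hn).1; omega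
      refine ⟨by rw [Finset.card_insert_of_notMem hn, hc], fun a ha => ?_⟩
      have hs : ∀ b ∈ s, b + 1 < n := fun b hb => (h b hb).1
      rcases Finset.mem_insert.1 ha with rfl | ha
      · refine ⟨by omega, fun h0 => ?_⟩
        rcases Finset.mem_insert.1 h0 with h0 | h0
        · omega
        · have := hs _ h0
          omega
      · have h1 := hs a ha
        refine ⟨by omega, fun h0 => ?_⟩
        rcases Finset.mem_insert.1 h0 with h0 | h0
        · omega
        · exact (h a ha).2 h0

theorem card_leftDots : ∀ n k : ℕ, (leftDots n k).card = (n - k).choose k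
  | n, 0 => by
    rw [Nat.choose_zero_right, Finset.card_eq_one]
    refine ⟨∅, Finset.ext fun s => ?_⟩
    rw [mem_leftDots, Finset.card_eq_zero, Finset.mem_singleton]
    exact ⟨fun h => h.1, fun h => ⟨h, by simp [h]⟩⟩
  | 0, k + 1 => by
    rw [Nat.zero_sub, Nat.choose_zero_succ, Finset.card_eq_zero, Finset.eq_empty_iff_forall_notMem]
    intro s hs
    obtain ⟨hc, h⟩ := mem_leftDots.1 hs
    obtain ⟨a, ha⟩ := Finset.card_pos.1 (hc.symm ▸ Nat.succ_pos k : 0 < s.card)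
    have := (h a ha).1
    omega
  | 1, k + 1 => by
    rw [Nat.sub_eq_zero_of_le (Nat.le_add_left 1 k), Nat.choose_zero_succ, Finset.card_eq_zero,
      Finset.eq_empty_iff_forall_notMem]
    intro s hs
    obtain ⟨hc, h⟩ := mem_leftDots.1 hs
    obtain ⟨a, ha⟩ := Finset.card_pos.1 (hc.symm ▸ Nat.succ_pos k : 0 < s.card)
    have := (h a ha).1
    omega
  | n + 2, k + 1 => by
    have hnot : ∀ s ∈ leftDots n k, n ∉ s := fun s hs hn => by
      have := ((mem_leftDots.1 hs).2 n hn).1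
      omega
    rw [leftDots_succ, Finset.card_union_of_disjoint, Finset.card_image_of_injOn,
      card_leftDots (n + 1) (k + 1), card_leftDots n k]
    · rw [Nat.add_sub_add_right, show n + 2 - (k + 1) = n + 1 - k by omega]
      -- Pascal's rule if $k\le n$. Otherwise the subtractions truncate to 0 and all three binomial
      -- coefficients vanish.
      rcases le_or_gt k n with h | h
      · rw [Nat.succ_sub h, Nat.choose_succ_succ, add_comm]
      · rw [Nat.choose_eq_zero_of_lt (by omega), Nat.choose_eq_zero_of_lt (by omega),
          Nat.choose_eq_zero_of_lt (by omega)]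
    · intro s hs t ht hst
      rw [← Finset.erase_insert (hnot s hs), ← Finset.erase_insert (hnot t ht)]
      exact congrArg (fun u : Finset ℕ => u.erase n) hst
    · rw [Finset.disjoint_left]
      intro s hs hs'
      obtain ⟨t, -, rfl⟩ := Finset.mem_image.1 hs'
      have := ((mem_leftDots.1 hs).2 n (Finset.mem_insert_self _ _)).1
      omega

/-- The number of pairings of `n` dots with `k` pairs. -/
theorem card_dotPairing (n k : ℕ) :
    (Finset.univ.filter fun s : DotPairing n => s.1.card = k).card = (n - k).choose k := by
  rw [← card_leftDots]
  refine Finset.card_bij (fun s _ => s.1.map Fin.valEmbedding) ?_ ?_ ?_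
  · intro s hs
    rw [mem_leftDots, Finset.card_map]
    refine ⟨(Finset.mem_filter.1 hs).2, ?_⟩
    intro a' ha'
    obtain ⟨a, ha, rfl⟩ := Finset.mem_map.1 ha'
    refine ⟨s.2.1 a ha, fun h => ?_⟩
    obtain ⟨b, hb, hba⟩ := Finset.mem_map.1 h
    exact s.2.2 a ha b hb hba
  · intro s _ t _ h
    exact Subtype.ext (Finset.map_injective _ h)
  · intro t ht
    obtain ⟨hc, h⟩ := mem_leftDots.1 ht
    have hlt : ∀ a ∈ t, a < n := fun a ha => by have := (h a ha).1; omega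
    have hmap : (t.attachFin hlt).map Fin.valEmbedding = t := by simp
    refine ⟨⟨t.attachFin hlt, fun a ha => ?_, fun a ha b hb hba => ?_⟩, ?_, hmap⟩
    · exact (h _ ((Finset.mem_attachFin hlt).1 ha)).1
    · have := (h _ ((Finset.mem_attachFin hlt).1 ha)).2
      rw [← hba] at this
      exact this ((Finset.mem_attachFin hlt).1 hb)
    · simp [hc]

/-! ## The Euler characteristic -/

/-- The generating function of the fibres of a map from a finite type. -/
theorem finsum_card_fiber {W τ : Type} [Fintype W] (d : W → τ) (f : τ → ℤ[T;T⁻¹]) :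
    ∑ᶠ t, ((Nat.card {w // d w = t} : ℕ) : ℤ[T;T⁻¹]) * f t = ∑ w, f (d w) := by
  classical
  -- Empty fibres contribute nothing, so the support lies in the finite image of `d` and the
  -- `finsum` is not the default value 0.
  rw [finsum_eq_sum_of_support_subset (s := Finset.univ.image d), Finset.sum_image' (f ∘ d)]
  · rfl
  · intro w _
    rw [Nat.card_eq_fintype_card, Fintype.card_subtype, ← nsmul_eq_mul, ← Finset.sum_const]
    refine Finset.sum_congr rfl fun w' hw' => ?_
    rw [Function.comp_apply, (Finset.mem_filter.1 hw').2]
  · intro t ht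
    by_contra h
    refine ht ?_
    have : IsEmpty {w // d w = t} := ⟨fun w => h (by
      rw [Finset.coe_image]
      exact ⟨w.1, by simp, w.2⟩)⟩
    simp

namespace LinkDiagram

open LaurentPolynomial

variable {ι X : Type}

instance finite_circles [Finite ι] [Finite X] (D : LinkDiagram ι X) (s : X → Bool) :
    Finite (D.Circles s) := by
  have : Finite (Quot (D.Joined s)) := Finite.of_surjective _ Quot.mk_surjective
  infer_instance

noncomputable instance fintypeCircles [Finite ι] [Finite X] (D : LinkDiagram ι X)
    (s : X → Bool) : Fintype (D.Circles s) := Fintype.ofFinite _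

/-- The Jones polynomial as a sum over smoothings with a set of marked circles. -/
theorem jones_eq_sum [Finite ι] [Fintype X] [DecidableEq X] (D : LinkDiagram ι X) :
    D.jones = ∑ s : X → Bool, ∑ S : Finset (D.Circles s),
      C (((height s : ℤ) - D.nNeg).negOnePow : ℤ) *
        T ((height s : ℤ) - D.nNeg + D.nPos - D.nNeg + Nat.card (D.Circles s) - 2 * S.card) := by
  rw [jones, Finset.mul_sum]
  refine Finset.sum_congr rfl fun s _ => ?_
  -- The summands are swapped so that a marked circle carries $q^{-1}$, the degree of a one-holed
  -- torus.
  rw [Nat.card_eq_fintype_card, add_comm (T 1), ← Fintype.sum_pow_mul_eq_add_pow, Finset.mul_sum,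
    Finset.mul_sum]
  refine Finset.sum_congr rfl fun S _ => ?_
  have hS : S.card ≤ Fintype.card (D.Circles s) := Finset.card_le_univ S
  have hsign : C (((height s : ℤ) - D.nNeg).negOnePow : ℤ) =
      (-1) ^ D.nNeg * (-1) ^ height s := by
    rw [Int.negOnePow_sub, Int.negOnePow_def, Int.negOnePow_def]
    simp [mul_comm]
  rw [hsign, neg_pow (T 1 : ℤ[T;T⁻¹])]
  simp only [T_pow]
  have hT : ∀ a b c d e : ℤ, e = a + b + c + d → (T e : ℤ[T;T⁻¹]) = T a * T b * T c * T d := by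
    rintro a b c d _ rfl
    simp only [T_add]
  rw [← Nat.card_eq_fintype_card] at hS ⊢
  rw [hT ((D.nPos : ℤ) - 2 * D.nNeg) (height s * 1) (S.card * -1)
    ((Nat.card (D.Circles s) - S.card : ℕ) * 1)
    ((height s : ℤ) - D.nNeg + D.nPos - D.nNeg + Nat.card (D.Circles s) - 2 * S.card) (by push_cast [hS]; ring)]
  ring

end LinkDiagram

-- Ensures that the `finrank` in `coloredKhDim` is a true dimension and not the default value 0.
set_option synthInstance.maxHeartbeats 400000 in
theorem MatObj.finite_tensor_FKhDegree (A : MatObj) (h : ∀ x, Finite (A.circles x)) (j : ℤ) :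
    Module.Finite ℚ (ℚ ⊗[ZHalf] A.FKhDegree j) := by
  have := A.finite_FKhDegree h j
  infer_instance

namespace LinkDiagram

open LaurentPolynomial

variable {ι X : Type}

/-- A sum over families of pairings, sorted by the numbers of pairs. -/
theorem sum_dotPairing_eq [Fintype ι] [DecidableEq ι] (n : ι → ℕ) (f : (ι → ℕ) → ℤ[T;T⁻¹]) :
    ∑ s : (x : ι) → DotPairing (n x), f (fun x => (s x).1.card) =
      ∑ k ∈ Fintype.piFinset fun i => Finset.range (n i / 2 + 1),
        ((∏ i, (n i - k i).choose (k i) : ℕ) : ℤ[T;T⁻¹]) * f k := by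
  rw [← Finset.sum_fiberwise_of_maps_to
    (t := Fintype.piFinset fun i => Finset.range (n i / 2 + 1))
    (g := fun (s : (x : ι) → DotPairing (n x)) x => (s x).1.card)]
  · refine Finset.sum_congr rfl fun k _ => ?_
    have hfib : (Finset.univ.filter fun s : (x : ι) → DotPairing (n x) =>
        (fun x => (s x).1.card) = k) =
        Fintype.piFinset fun x => Finset.univ.filter fun s : DotPairing (n x) =>
          s.1.card = k x := by
      ext s
      simp [funext_iff]
    rw [Finset.sum_congr rfl (g := fun _ => f k) fun s hs => by rw [(Finset.mem_filter.1 hs).2],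
      Finset.sum_const, hfib, Fintype.card_piFinset, nsmul_eq_mul]
    simp only [card_dotPairing]
  · intro s _
    rw [Fintype.mem_piFinset]
    intro x
    -- A pairing with $k$ pairs exists, so $\binom{n-k}{k}>0$ and $k\le n-k$, which puts $k$ in the
    -- range of summation.
    have h : 0 < (n x - (s x).1.card).choose (s x).1.card := by
      rw [← card_dotPairing, Finset.card_pos]
      exact ⟨s x, by simp⟩
    have h' : (s x).1.card ≤ n x - (s x).1.card := by
      by_contra h0
      exact h.ne' (Nat.choose_eq_zero_of_lt (not_le.1 h0))
    rw [Finset.mem_range]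
    omega

/-! ### Marked smoothings and the comparison of the two polynomials. -/

variable [Fintype ι] [Fintype X]

/-- The diagram that remains after the dots of a family of pairings are removed. -/
abbrev pairedCable (D : LinkDiagram ι X) (n : ι → ℕ) (s : (x : ι) → DotPairing (n x)) :
    LinkDiagram (Σ x, Fin (n x - 2 * (s x).1.card))
      (D.CableCrossing fun x => n x - 2 * (s x).1.card) :=
  D.cable fun x => n x - 2 * (s x).1.card

/-- The smoothings of the cables with a set of marked circles, which index a basis of the value of
the Khovanov functor on the colored Khovanov bracket. -/
abbrev MarkedSmoothing (D : LinkDiagram ι X) (n : ι → ℕ) : Type :=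
  Σ s : (x : ι) → DotPairing (n x),
    Σ σ : (D.CableCrossing fun x => n x - 2 * (s x).1.card) → Bool,
      Finset ((D.pairedCable n s).Circles σ)

/-- The tridegree of a basis element. -/
noncomputable def MarkedSmoothing.degree {D : LinkDiagram ι X} {n : ι → ℕ}
    (w : D.MarkedSmoothing n) : ℕ × ℤ × ℤ :=
  (∑ x, (w.1 x).1.card, (height w.2.1 : ℤ) - (D.pairedCable n w.1).nNeg,
    (height w.2.1 : ℤ) - (D.pairedCable n w.1).nNeg + (D.pairedCable n w.1).nPos -
      (D.pairedCable n w.1).nNeg + Nat.card ((D.pairedCable n w.1).Circles w.2.1) -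
      2 * w.2.2.card)

theorem finite_circles_coloredKhChain (D : LinkDiagram ι X) (n : ι → ℕ) (i : ℕ) (r : ℤ)
    (x : (D.coloredKhChain n i r).index) : Finite ((D.coloredKhChain n i r).circles x) :=
  finite_circles (D.pairedCable n x.1.1) x.2.1

/-- The basis elements in tridegree `t` form a fibre of one map on one finite type, so the triple
sum defining $\chi$ collapses to a sum over that type by `finsum_card_fiber`. -/
theorem coloredKhDim_eq (D : LinkDiagram ι X) (n : ι → ℕ) (t : ℕ × ℤ × ℤ) :
    D.coloredKhDim n t.1 t.2.1 t.2.2 =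
      Nat.card {w : D.MarkedSmoothing n // w.degree = t} := by
  obtain ⟨i, r, j⟩ := t
  rw [coloredKhDim, MatObj.finrank_FKhDegree _ (D.finite_circles_coloredKhChain n i r)]
  refine Nat.card_congr
    { toFun := fun y => ⟨⟨y.1.1.1, y.1.2.1, y.2.1⟩, ?_⟩
      invFun := fun w => ⟨⟨⟨w.1.1, congrArg Prod.fst w.2⟩,
        ⟨w.1.2.1, congrArg (fun t => t.2.1) w.2⟩⟩, ⟨w.1.2.2, ?_⟩⟩
      left_inv := fun _ => rfl
      right_inv := fun _ => rfl }
  · obtain ⟨⟨⟨s, hs⟩, ⟨σ, hσ⟩⟩, ⟨S, hS⟩⟩ := y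
    change r + (D.pairedCable n s).nPos - (D.pairedCable n s).nNeg +
      Nat.card ((D.pairedCable n s).Circles σ) - 2 * S.card = j at hS
    exact Prod.ext hs (Prod.ext hσ ((congrArg (fun a : ℤ => a + (D.pairedCable n s).nPos -
      (D.pairedCable n s).nNeg + Nat.card ((D.pairedCable n s).Circles σ) - 2 * S.card) hσ).trans
      hS))
  · obtain ⟨⟨s, σ, S⟩, h⟩ := w
    have hσ : (height σ : ℤ) - (D.pairedCable n s).nNeg = r := congrArg (fun t => t.2.1) h
    have hS := congrArg (fun t => t.2.2) h
    dsimp only [MarkedSmoothing.degree] at hS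
    rw [hσ] at hS
    exact hS

/-- The total graded Euler characteristic as a sum over the basis. -/
theorem coloredKhEuler_eq_sum [DecidableEq ι] [DecidableEq X] (D : LinkDiagram ι X) (n : ι → ℕ) :
    D.coloredKhEuler n = ∑ w : D.MarkedSmoothing n,
      C ((w.degree.1 + w.degree.2.1 : ℤ).negOnePow : ℤ) * T w.degree.2.2 := by
  rw [coloredKhEuler, ← finsum_card_fiber (MarkedSmoothing.degree (D := D) (n := n))
    fun t => C ((t.1 + t.2.1 : ℤ).negOnePow : ℤ) * T t.2.2]
  refine finsum_congr fun t => ?_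
  rw [coloredKhDim_eq, map_mul]
  simp only [map_natCast]
  ring

theorem coloredKhEuler_eq_coloredJones [DecidableEq ι] [DecidableEq X] (D : LinkDiagram ι X)
    (n : ι → ℕ) : D.coloredKhEuler n = D.coloredJones n := by
  have h : D.coloredJones n = ∑ s : (x : ι) → DotPairing (n x),
      (-1) ^ (∑ x, (s x).1.card) * (D.pairedCable n s).jones := by
    rw [sum_dotPairing_eq n fun k =>
      (-1) ^ (∑ i, k i) * (D.cable fun i => n i - 2 * k i).jones, coloredJones]
    exact Finset.sum_congr rfl fun k _ => by ring
  rw [h, coloredKhEuler_eq_sum, Fintype.sum_sigma]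
  refine Finset.sum_congr rfl fun s _ => ?_
  rw [jones_eq_sum, Fintype.sum_sigma, Finset.mul_sum]
  refine Finset.sum_congr rfl fun σ _ => ?_
  rw [Finset.mul_sum]
  refine Finset.sum_congr rfl fun S _ => ?_
  -- The sign $(-1)^{i+r}$ splits: $(-1)^r$ belongs to the Jones polynomial and
  -- $(-1)^i=(-1)^{|\mathbf k|}$ to the sum over pairings.
  simp only [MarkedSmoothing.degree, Int.negOnePow_add, Units.val_mul, map_mul, mul_assoc]
  congr 1
  rw [Int.negOnePow_def, zpow_natCast]
  simp

end LinkDiagram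

theorem corollary2 {ι X : Type} [Fintype ι] [DecidableEq ι] [Fintype X] [DecidableEq X]
    (D : LinkDiagram ι X) (hD : D.IsPlanar) (n : ι → ℕ) :
    (∀ i r j, Module.Finite ℚ (ℚ ⊗[ZHalf] (D.coloredKhChain n i r).FKhDegree j)) ∧
    {t : ℕ × ℤ × ℤ | D.coloredKhDim n t.1 t.2.1 t.2.2 ≠ 0}.Finite ∧
    D.coloredKhEuler n = D.coloredJones n := by
  refine ⟨fun i r j => MatObj.finite_tensor_FKhDegree _
    (D.finite_circles_coloredKhChain n i r) j, ?_, D.coloredKhEuler_eq_coloredJones n⟩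
  -- A nonzero dimension needs a marked smoothing of that tridegree, and there are only finitely
  -- many of them.
  refine (Set.finite_range (LinkDiagram.MarkedSmoothing.degree (D := D) (n := n))).subset ?_
  intro t ht
  rw [Set.mem_ofPred_eq, LinkDiagram.coloredKhDim_eq] at ht
  obtain ⟨⟨w, hw⟩⟩ := (Nat.card_ne_zero.1 ht).1
  exact ⟨w, hw⟩
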